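/- For a real $N\times L$ matrix $G$ ($L\ge 1$) let $\theta_{\max}=\max_i\|Ge_i\|_2$ and $\theta_{\min}=\min_i\|Ge_i\|_2$ be its largest and smallest column norms, and, when $\theta_{\min}>0$, let $\mu=\theta_{\max}^2/\theta_{\min}^2\ge 1$. Let $\phi_1,\dots,\phi_K\in\{\pm1\}^L$ be random masks whose $KL$ entries are independent and equal to $+1$ or $-1$ with probability $1/2$ each, and let $$H=\begin{bmatrix}GD_{\phi_1}\\ \vdots\\ GD_{\phi_K}\end{bmatrix}\in\mathbb{R}^{KN\times L},$$ where $D_{\phi}$ is the diagonal matrix with diagonal $\phi$. There exist absolute constants $\mu_0>1$, $c>0$, $C>0$ and $\delta\in(0,1)$ such that the following holds for all $N,L,K,S$ with $L\ge1$, every $N\times L$ matrix $G$ with $\theta_{\min}>0$ and $\mu\le\mu_0$, and every $x^\star\in\mathbb{R}^L$ with at most $S$ nonzero entries. If $$K\ \ge\ c\,\mu^2\,S\log L,$$ then, with $y=Hx^\star$, the vector $x^\star$ is the unique solution of $$\min_{x\in\mathbb{R}^L}\ \|x\|_1\quad\text{subject to}\quad Hx=y$$ with probability at least $$1-2\exp\!\left(-CK\min\left\{\frac{\delta}{2\mu},\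 \frac{\delta^2}{(2\mu)^2}\right\}\right).$$ -/

import Mathlib

open MeasureTheory ProbabilityTheory
open scoped Matrix

noncomputable section

namespace MaskedImaging

/-- The Euclidean norm `‖G eᵢ‖₂` of the `i`-th column of `G`. -/
def colNorm {N L : ℕ} (G : Matrix (Fin N) (Fin L) ℝ) (i : Fin L) : ℝ :=
  ‖(WithLp.toLp 2 (G *ᵥ Pi.single i 1) : EuclideanSpace ℝ (Fin N))‖

/-- The largest column norm of `G` (used for `L ≥ 1`, where the supremum is a maximum). -/
def thetaMax {N L : ℕ} (G : Matrix (Fin N) (Fin L) ℝ) : ℝ := ⨆ i, colNorm G i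

/-- The smallest column norm of `G` (used for `L ≥ 1`, where the infimum is a minimum). -/
def thetaMin {N L : ℕ} (G : Matrix (Fin N) (Fin L) ℝ) : ℝ := ⨅ i, colNorm G i

/-- The ratio `μ = θ_max² / θ_min²` (used for `θ_min > 0`). -/
def muRatio {N L : ℕ} (G : Matrix (Fin N) (Fin L) ℝ) : ℝ := thetaMax G ^ 2 / thetaMin G ^ 2

/-- The measurement matrix `H`, which stacks the blocks `G D_{φ₁}, …, G D_{φ_K}`, where `D_φ` is
the diagonal matrix with diagonal `φ`. The row `(k, n)` is the `n`-th row of the `k`-th block. -/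
def measMatrix {N L K : ℕ} (G : Matrix (Fin N) (Fin L) ℝ) (φ : Fin K → Fin L → ℝ) :
    Matrix (Fin K × Fin N) (Fin L) ℝ :=
  Matrix.of fun p l => (G * Matrix.diagonal (φ p.1)) p.2 l

/-- `x` has at most `S` nonzero entries. -/
def IsSparse {L : ℕ} (S : ℕ) (x : Fin L → ℝ) : Prop := {i | x i ≠ 0}.ncard ≤ S

/-- The `ℓ₁` norm. -/
def l1norm {L : ℕ} (x : Fin L → ℝ) : ℝ := ∑ i, |x i|

/-- The set of solutions of: minimize `‖x‖₁` subject to `H x = y`. -/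
def l1Argmin {m : Type*} {L : ℕ} (H : Matrix m (Fin L) ℝ) (y : m → ℝ) : Set (Fin L → ℝ) :=
  {x | H *ᵥ x = y ∧ ∀ z, H *ᵥ z = y → l1norm x ≤ l1norm z}

/-- The entries `φ k l` of the `K` masks are jointly independent random variables, each taking the
values `1` and `-1` with probability `1/2`. -/
structure IsRademacherMasks {Ω : Type*} [MeasurableSpace Ω] (P : Measure Ω) {K L : ℕ}
    (φ : Fin K → Fin L → Ω → ℝ) : Prop where
  measurable : ∀ k l, Measurable (φ k l)
  indep : iIndepFun (fun p : Fin K × Fin L => φ p.1 p.2) P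
  prob_one : ∀ k l, P {ω | φ k l ω = 1} = 1 / 2
  prob_neg_one : ∀ k l, P {ω | φ k l ω = -1} = 1 / 2

end MaskedImaging

end

namespace MaskedImaging

/-! Recovery needs only that no nonzero `h` with `‖h‖₁² ≤ 4S‖h‖₂²` lies in the kernel of `H`
(`l1Argmin_eq_singleton`), so a one-sided bound replaces the restricted isometry property and no
nets are used. For fixed `z`, `‖Hz‖²` is a sum of `K` independent nonnegative terms, each with
fourth-moment control, so it falls below half its mean with probability at most `exp (-K/24)`
(`card_signs_lower_tail_le`). A union bound covers the `(2L)^(81S)` signed sums of `81S` coordinate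
vectors.

Maurey's lemma passes from these sums to all `h` (`map_ne_zero_of_le_signedSum`): a signed sum `z`
approximates a multiple of `h` both in `ℓ₂` and after applying `H`. If `Hh = 0`, then `Hz` is small,
so `z` is small by the lower bound, and so is `h`, contradicting `‖h‖₁² ≤ 4S‖h‖₂²`. Probabilities
are handled by counting sign patterns. -/

/-- The sign `1` or `-1` encoded by a Boolean. -/
def boolSign (b : Bool) : ℝ := if b then 1 else -1

theorem boolSign_sq (b : Bool) : boolSign b ^ 2 = 1 := by
  cases b <;> simp [boolSign]

/-! ### Rademacher sums of vectors: moments and lower tail -/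

section SignSums

variable {E : Type*} [NormedAddCommGroup E] [InnerProductSpace ℝ E]

theorem sum_signs_succ {M : Type*} [AddCommMonoid M] {n : ℕ} (f : (Fin (n + 1) → Bool) → M) :
    ∑ ε, f ε = ∑ ε : Fin n → Bool, (f (Fin.cons true ε) + f (Fin.cons false ε)) := by
  rw [← (Fin.consEquiv (fun _ : Fin (n + 1) => Bool)).sum_comp, Fintype.sum_prod_type,
    Fintype.sum_bool, ← Finset.sum_add_distrib]
  rfl

/-- The second moment of a Rademacher sum of vectors. -/
theorem sum_signs_norm_sq {n : ℕ} (v : Fin n → E) :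
    ∑ ε : Fin n → Bool, ‖∑ j, boolSign (ε j) • v j‖ ^ 2 = 2 ^ n * ∑ j, ‖v j‖ ^ 2 := by
  induction n with
  | zero => simp
  | succ n ih =>
    rw [sum_signs_succ, Fin.sum_univ_succ (fun j => ‖v j‖ ^ 2)]
    have key : ∀ ε : Fin n → Bool,
        ‖∑ j, boolSign ((Fin.cons true ε : Fin (n + 1) → Bool) j) • v j‖ ^ 2 +
          ‖∑ j, boolSign ((Fin.cons false ε : Fin (n + 1) → Bool) j) • v j‖ ^ 2 =
        2 * ‖v 0‖ ^ 2 + 2 * ‖∑ j, boolSign (ε j) • v j.succ‖ ^ 2 := by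
      intro ε
      simp only [Fin.sum_univ_succ, Fin.cons_zero, Fin.cons_succ]
      rw [norm_add_sq_real, norm_add_sq_real]
      simp [boolSign]
      ring
    rw [Finset.sum_congr rfl fun ε _ => key ε, Finset.sum_add_distrib, ← Finset.mul_sum, ← Finset.mul_sum,
      ih fun j => v j.succ]
    simp
    ring

/-- The fourth moment of a Rademacher sum of vectors. -/
theorem sum_signs_norm_pow_four_le {n : ℕ} (v : Fin n → E) :
    ∑ ε : Fin n → Bool, ‖∑ j, boolSign (ε j) • v j‖ ^ 4 ≤
      3 * 2 ^ n * (∑ j, ‖v j‖ ^ 2) ^ 2 := by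
  induction n with
  | zero => simp
  | succ n ih =>
    rw [sum_signs_succ, Fin.sum_univ_succ (fun j => ‖v j‖ ^ 2)]
    -- Averaging over the first sign cancels the odd terms; Cauchy–Schwarz bounds the squared inner
    -- product that remains.
    have key : ∀ ε : Fin n → Bool,
        ‖∑ j, boolSign ((Fin.cons true ε : Fin (n + 1) → Bool) j) • v j‖ ^ 4 +
          ‖∑ j, boolSign ((Fin.cons false ε : Fin (n + 1) → Bool) j) • v j‖ ^ 4 ≤
        2 * ‖v 0‖ ^ 4 + 2 * ‖∑ j, boolSign (ε j) • v j.succ‖ ^ 4 +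
          12 * ‖v 0‖ ^ 2 * ‖∑ j, boolSign (ε j) • v j.succ‖ ^ 2 := by
      intro ε
      simp only [Fin.sum_univ_succ, Fin.cons_zero, Fin.cons_succ]
      set w := ∑ j, boolSign (ε j) • v j.succ
      have h1 : ‖boolSign true • v 0 + w‖ ^ 2 =
          ‖v 0‖ ^ 2 + 2 * inner ℝ (v 0) w + ‖w‖ ^ 2 := by
        rw [norm_add_sq_real]; simp [boolSign]
      have h2 : ‖boolSign false • v 0 + w‖ ^ 2 =
          ‖v 0‖ ^ 2 - 2 * inner ℝ (v 0) w + ‖w‖ ^ 2 := by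
        rw [norm_add_sq_real]; simp [boolSign]; ring
      have h3 : (inner ℝ (v 0) w) ^ 2 ≤ ‖v 0‖ ^ 2 * ‖w‖ ^ 2 := by
        rw [← mul_pow]
        exact sq_le_sq' (neg_le_of_abs_le (abs_real_inner_le_norm _ _)) (real_inner_le_norm _ _)
      have h4 : ∀ x : ℝ, x ^ 4 = (x ^ 2) ^ 2 := fun x => by ring
      rw [h4, h4 ‖boolSign false • v 0 + w‖, h1, h2]
      nlinarith [h3]
    refine (Finset.sum_le_sum fun ε _ => key ε).trans ?_
    rw [Finset.sum_add_distrib, Finset.sum_add_distrib, ← Finset.mul_sum, ← Finset.mul_sum,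
      ← Finset.mul_sum, sum_signs_norm_sq fun j => v j.succ]
    have := ih fun j => v j.succ
    simp only [Finset.sum_const, Finset.card_univ, Fintype.card_fun, Fintype.card_bool,
      Fintype.card_fin, nsmul_eq_mul, Nat.cast_pow, Nat.cast_ofNat]
    have h2 : (0 : ℝ) ≤ 2 ^ n * ‖v 0‖ ^ 4 := by positivity
    rw [pow_succ (2 : ℝ) n]
    nlinarith

/-- Follows from `(1 - x + x²/2)(1 + x + x²/2) = 1 + x⁴/4 ≥ 1`. -/
theorem exp_neg_le_quadratic {x : ℝ} (hx : 0 ≤ x) : Real.exp (-x) ≤ 1 - x + x ^ 2 / 2 := by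
  rw [Real.exp_neg, inv_le_iff_one_le_mul₀ (Real.exp_pos x)]
  have h1 := Real.quadratic_le_exp_of_nonneg hx
  have h2 : 0 ≤ 1 - x + x ^ 2 / 2 := by nlinarith [sq_nonneg (x - 1)]
  have h3 := mul_le_mul_of_nonneg_left h1 h2
  nlinarith [sq_nonneg (x ^ 2)]

/-- For negative exponents the second-order bound on `exp` is global, so the second and fourth
moments suffice. -/
theorem sum_signs_exp_neg_le {n : ℕ} (v : Fin n → E) {r : ℝ} (hr : 0 ≤ r) :
    ∑ ε : Fin n → Bool, Real.exp (-(r * ‖∑ j, boolSign (ε j) • v j‖ ^ 2)) ≤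
      2 ^ n * Real.exp (-(r * ∑ j, ‖v j‖ ^ 2) + 3 / 2 * (r * ∑ j, ‖v j‖ ^ 2) ^ 2) := by
  have h1 : ∑ ε : Fin n → Bool, Real.exp (-(r * ‖∑ j, boolSign (ε j) • v j‖ ^ 2)) ≤
      ∑ ε : Fin n → Bool, (1 - r * ‖∑ j, boolSign (ε j) • v j‖ ^ 2 +
        r ^ 2 / 2 * ‖∑ j, boolSign (ε j) • v j‖ ^ 4) := by
    refine Finset.sum_le_sum fun ε _ => ?_
    refine (exp_neg_le_quadratic (by positivity)).trans (le_of_eq (by ring))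
  refine h1.trans ?_
  rw [Finset.sum_add_distrib, Finset.sum_sub_distrib, ← Finset.mul_sum, ← Finset.mul_sum,
    sum_signs_norm_sq]
  have h2 := mul_le_mul_of_nonneg_left (sum_signs_norm_pow_four_le v)
    (by positivity : 0 ≤ r ^ 2 / 2)
  have h3 := mul_le_mul_of_nonneg_left (Real.add_one_le_exp
    (-(r * ∑ j, ‖v j‖ ^ 2) + 3 / 2 * (r * ∑ j, ‖v j‖ ^ 2) ^ 2))
    (by positivity : (0 : ℝ) ≤ 2 ^ n)
  simp only [Finset.sum_const, Finset.card_univ, Fintype.card_fun, Fintype.card_bool,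
    Fintype.card_fin, nsmul_eq_mul, Nat.cast_pow, Nat.cast_ofNat]
  nlinarith

/-- A lower tail bound: among all families of `K` sign patterns, only a proportion `exp (-K / 24)`
makes the sum of squared norms smaller than half its mean. -/
theorem card_signs_lower_tail_le {n : ℕ} (K : ℕ) (v : Fin n → E) :
    ((Finset.univ.filter fun ε : Fin K → Fin n → Bool =>
        ∑ k, ‖∑ j, boolSign (ε k j) • v j‖ ^ 2 < K / 2 * ∑ j, ‖v j‖ ^ 2).card : ℝ) ≤
      2 ^ (K * n) * Real.exp (-(K / 24)) := by
  set τ := ∑ j, ‖v j‖ ^ 2 with hτ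
  have hτ0 : 0 ≤ τ := by positivity
  rcases hτ0.eq_or_lt with h0 | hpos
  · rw [← h0, Finset.filter_false_of_mem]
    · simp; positivity
    · intro ε _
      simp only [mul_zero, not_lt]
      positivity
  -- With `t = r * τ`, the Chernoff exponent per mask is `t/2 - t + 3t²/2`, minimal at `t = 1/6`
  -- with value `-1/24`.
  set r := 1 / (6 * τ) with hr
  have hrτ : r * τ = 1 / 6 := by rw [hr]; field_simp
  have hr0 : 0 ≤ r := by positivity
  have h1 : ((Finset.univ.filter fun ε : Fin K → Fin n → Bool =>
        ∑ k, ‖∑ j, boolSign (ε k j) • v j‖ ^ 2 < K / 2 * τ).card : ℝ) ≤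
      ∑ ε : Fin K → Fin n → Bool, Real.exp (K / 12) *
        ∏ k, Real.exp (-(r * ‖∑ j, boolSign (ε k j) • v j‖ ^ 2)) := by
    rw [Finset.card_filter, Nat.cast_sum]
    refine Finset.sum_le_sum fun ε _ => ?_
    rw [← Real.exp_sum, ← Real.exp_add]
    split_ifs with h
    · rw [Nat.cast_one, Real.one_le_exp_iff, Finset.sum_neg_distrib, ← Finset.mul_sum]
      have h2 := mul_le_mul_of_nonneg_left h.le hr0
      have h3 : r * (K / 2 * τ) = K / 12 := by linear_combination (K / 2 : ℝ) * hrτ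
      linarith
    · rw [Nat.cast_zero]; positivity
  refine h1.trans ?_
  rw [← Finset.mul_sum,
    ← Fintype.sum_pow (fun e : Fin n → Bool => Real.exp (-(r * ‖∑ j, boolSign (e j) • v j‖ ^ 2)))]
  have h2 := pow_le_pow_left₀ (by positivity) (sum_signs_exp_neg_le v hr0) K
  rw [← hτ, hrτ, mul_pow, ← pow_mul, ← Real.exp_nat_mul] at h2
  refine (mul_le_mul_of_nonneg_left h2 (Real.exp_pos _).le).trans (le_of_eq ?_)
  rw [mul_left_comm, ← Real.exp_add, mul_comm n K]
  congr 2
  ring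

/-! ### Maurey's lemma and sparsification -/

/-- Maurey's approximation lemma: a convex combination of vectors of norm at most `√B` is
approximated by averages of `m` of them. -/
theorem exists_sum_approx_convex_comb {ι : Type*} [Fintype ι] (w : ι → E) (p : ι → ℝ)
    (hp : ∀ i, 0 ≤ p i) (hp1 : ∑ i, p i = 1) {B : ℝ} (hB : ∀ i, ‖w i‖ ^ 2 ≤ B) (m : ℕ) :
    ∃ f : Fin m → ι, ‖∑ r, w (f r) - (m : ℝ) • ∑ i, p i • w i‖ ^ 2 ≤ m * B := by
  set h := ∑ i, p i • w i with hh
  induction m with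
  | zero => exact ⟨Fin.elim0, by simp⟩
  | succ m ih =>
    obtain ⟨f, hf⟩ := ih
    obtain ⟨u, hu⟩ : ∃ u, u = ∑ r, w (f r) - (m : ℝ) • h := ⟨_, rfl⟩
    rw [← hu] at hf
    -- Since `w i - h` has mean zero under `p`, the cross term vanishes on average; some `i` does at
    -- least as well as the mean, so `f` can be chosen greedily.
    have hmean : ∑ i, p i * ‖u + (w i - h)‖ ^ 2 ≤ ∑ i, p i * (‖u‖ ^ 2 + B) := by
      have e1 : ∀ i, p i * ‖u + (w i - h)‖ ^ 2 =
          p i * (‖u‖ ^ 2 + ‖w i‖ ^ 2) + (2 * inner ℝ (u - h) (p i • w i))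
            + p i * (‖h‖ ^ 2 - 2 * inner ℝ u h) := by
        intro i
        rw [norm_add_sq_real, norm_sub_sq_real, inner_sub_right, inner_sub_left, inner_smul_right,
          inner_smul_right, real_inner_comm (w i) h]
        ring
      rw [Finset.sum_congr rfl fun i _ => e1 i, Finset.sum_add_distrib, Finset.sum_add_distrib,
        ← Finset.mul_sum, ← inner_sum, ← hh, ← Finset.sum_mul, hp1, inner_sub_left,
        real_inner_self_eq_norm_sq]
      have : ∑ i, p i * (‖u‖ ^ 2 + ‖w i‖ ^ 2) ≤ ∑ i, p i * (‖u‖ ^ 2 + B) :=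
        Finset.sum_le_sum fun i _ => mul_le_mul_of_nonneg_left (by linarith [hB i]) (hp i)
      nlinarith [sq_nonneg ‖h‖]
    have hex : ∃ i, ‖u + (w i - h)‖ ^ 2 ≤ ‖u‖ ^ 2 + B := by
      by_contra! hcon
      have hne : ∃ i, 0 < p i := by
        by_contra! hle
        have := Finset.sum_nonpos fun i (_ : i ∈ Finset.univ) => hle i
        linarith
      obtain ⟨i, hi⟩ := hne
      exact absurd hmean (not_le.mpr (Finset.sum_lt_sum
        (fun i _ => mul_le_mul_of_nonneg_left (hcon i).le (hp i))
        ⟨i, Finset.mem_univ i, mul_lt_mul_of_pos_left (hcon i) hi⟩))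
    obtain ⟨i, hi⟩ := hex
    refine ⟨Fin.snoc f i, ?_⟩
    have e2 : ∑ r, w ((Fin.snoc f i : Fin (m + 1) → ι) r) - ((m + 1 : ℕ) : ℝ) • h =
        u + (w i - h) := by
      simp only [Fin.sum_univ_castSucc, Fin.snoc_castSucc, Fin.snoc_last, hu]
      push_cast
      module
    rw [e2]
    push_cast
    linarith

end SignSums

/-- The integer vector `∑ᵣ ± eⱼᵣ` given by a sequence of signed coordinates. -/
def signedSum {m L : ℕ} (f : Fin m → Fin L × Bool) : Fin L → ℝ :=
  ∑ r, boolSign (f r).2 • Pi.single (f r).1 1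

section Sparsification

variable {E : Type*} [NormedAddCommGroup E] [InnerProductSpace ℝ E]

/-- Maurey's lemma for the `ℓ₁` sphere, applied simultaneously to a linear map and to the
Euclidean norm. -/
theorem exists_signedSum_approx {L : ℕ} (A : (Fin L → ℝ) →ₗ[ℝ] E) {B : ℝ} (hB0 : 0 ≤ B)
    (hB : ∀ j, ‖A (Pi.single j 1)‖ ^ 2 ≤ B) {h : Fin L → ℝ} (hh : l1norm h = 1) (m : ℕ) :
    ∃ f : Fin m → Fin L × Bool,
      ‖A (signedSum f) - (m : ℝ) • A h‖ ^ 2 + B * ∑ j, (signedSum f j - m * h j) ^ 2 ≤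
        m * (2 * B) := by
  -- Taking `x ↦ (A x, √B x)` in the Hilbert sum makes one selection serve both norms; each signed
  -- coordinate vector has squared image norm at most `2B`.
  let T : (Fin L → ℝ) →ₗ[ℝ] WithLp 2 (E × EuclideanSpace ℝ (Fin L)) :=
    (WithLp.linearEquiv 2 ℝ (E × EuclideanSpace ℝ (Fin L))).symm.toLinearMap ∘ₗ
      (A.prod (√B • (WithLp.linearEquiv 2 ℝ (Fin L → ℝ)).symm.toLinearMap))
  have hT : ∀ x, ‖T x‖ ^ 2 = ‖A x‖ ^ 2 + B * ∑ j, x j ^ 2 := by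
    intro x
    rw [WithLp.prod_norm_sq_eq_of_L2]
    change ‖A x‖ ^ 2 + ‖√B • (WithLp.toLp 2 x : EuclideanSpace ℝ (Fin L))‖ ^ 2 = _
    rw [norm_smul, mul_pow, EuclideanSpace.norm_sq_eq]
    simp [Real.sq_sqrt hB0, abs_of_nonneg (Real.sqrt_nonneg B)]
  let s : Fin L → Bool := fun j => decide (0 ≤ h j)
  have hs : ∀ j, |h j| * boolSign (s j) = h j := by
    intro j
    by_cases hj : 0 ≤ h j
    · simp [s, boolSign, hj, abs_of_nonneg hj]
    · simp [s, boolSign, hj, abs_of_neg (not_le.mp hj)]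
  have hw : ∀ j, ‖T (boolSign (s j) • Pi.single j 1)‖ ^ 2 ≤ 2 * B := by
    intro j
    rw [map_smul, norm_smul, mul_pow, Real.norm_eq_abs, sq_abs, boolSign_sq, one_mul, hT]
    have : ∑ i, (Pi.single j (1 : ℝ) : Fin L → ℝ) i ^ 2 = 1 := by
      rw [Finset.sum_eq_single j] <;> simp +contextual
    rw [this]
    linarith [hB j]
  obtain ⟨f, hf⟩ := exists_sum_approx_convex_comb
    (fun j => T (boolSign (s j) • Pi.single j 1)) (fun j => |h j|) (fun j => abs_nonneg _) hh hw m
  refine ⟨fun r => (f r, s (f r)), ?_⟩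
  have e1 : ∑ j, |h j| • T (boolSign (s j) • Pi.single j 1) = T h := by
    simp_rw [← map_smul, ← map_sum, smul_smul, hs]
    congr 1
    ext j
    simp [Finset.sum_apply, Pi.single_apply]
  rw [e1, ← map_sum, ← map_smul, ← map_sub, hT, map_sub, map_smul] at hf
  simpa [signedSum] using hf

/-- If a linear map is bounded below on all signed sums of `81 S` coordinate vectors, then its
kernel contains no nonzero vector that is effectively `4 S`-sparse. -/
theorem map_ne_zero_of_le_signedSum {L S : ℕ} (A : (Fin L → ℝ) →ₗ[ℝ] E) {a B : ℝ} (ha : 0 < a)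
    (hB0 : 0 < B) (hBa : B ≤ 4 * a) (hB : ∀ j, ‖A (Pi.single j 1)‖ ^ 2 ≤ B)
    (hA : ∀ f : Fin (81 * S) → Fin L × Bool,
      a * ∑ j, signedSum f j ^ 2 ≤ ‖A (signedSum f)‖ ^ 2)
    {h : Fin L → ℝ} (hne : h ≠ 0) (hcone : l1norm h ^ 2 ≤ 4 * S * ∑ j, h j ^ 2) :
    A h ≠ 0 := by
  intro hker
  have hl1 : 0 < l1norm h := by
    obtain ⟨j, hj⟩ := Function.ne_iff.mp hne
    exact Finset.sum_pos' (fun i _ => abs_nonneg _) ⟨j, Finset.mem_univ j, abs_pos.mpr hj⟩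
  wlog hnorm : l1norm h = 1 generalizing h
  · have hsc : l1norm ((l1norm h)⁻¹ • h) = 1 := by
      simp only [l1norm, Pi.smul_apply, smul_eq_mul, abs_mul, ← Finset.mul_sum]
      change |(l1norm h)⁻¹| * l1norm h = 1
      rw [abs_of_pos (inv_pos.mpr hl1), inv_mul_cancel₀ hl1.ne']
    refine this (smul_ne_zero (inv_ne_zero hl1.ne') hne) ?_ (by rw [map_smul, hker, smul_zero])
      (by rw [hsc]; exact one_pos) hsc
    simp only [hsc, Pi.smul_apply, smul_eq_mul, mul_pow, ← Finset.mul_sum]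
    have := mul_le_mul_of_nonneg_left hcone (sq_nonneg (l1norm h)⁻¹)
    rw [← mul_pow, inv_mul_cancel₀ hl1.ne'] at this
    linarith
  have hS : 0 < (S : ℝ) := by
    rcases Nat.eq_zero_or_pos S with h0 | h0
    · subst h0
      rw [hnorm] at hcone
      norm_num at hcone
    · exact_mod_cast h0
  -- With `m = 81S` and `A h = 0`, this gives `X ≤ 8m` and `Y ≤ 2m`, so `m²W ≤ 20m`. As `W ≥
  -- 1/(4S)`, this would force `m ≤ 80S`.
  obtain ⟨f, hf⟩ := exists_signedSum_approx A hB0.le hB hnorm (81 * S)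
  have hz := hA f
  rw [hker, smul_zero, sub_zero] at hf
  push_cast at hf
  rw [hnorm] at hcone
  set X := ∑ j, signedSum f j ^ 2
  set Y := ∑ j, (signedSum f j - 81 * (S : ℝ) * h j) ^ 2
  set W := ∑ j, h j ^ 2
  have hX : 0 ≤ X := by positivity
  have hY : 0 ≤ Y := by positivity
  have hXYW : (81 * (S : ℝ)) ^ 2 * W ≤ 2 * X + 2 * Y := by
    simp only [X, Y, W, Finset.mul_sum, ← Finset.sum_add_distrib]
    refine Finset.sum_le_sum fun j _ => ?_
    nlinarith [sq_nonneg (2 * signedSum f j - 81 * (S : ℝ) * h j)]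
  have hX' : X ≤ 8 * (81 * S) := by
    have h1 : a * X ≤ a * (8 * (81 * S)) := by
      have := mul_nonneg hB0.le hY
      nlinarith
    exact le_of_mul_le_mul_left h1 ha
  have hY' : B * Y ≤ B * (2 * (81 * S)) := by
    nlinarith [mul_nonneg ha.le hX]
  have hY'' : Y ≤ 2 * (81 * S) := le_of_mul_le_mul_left hY' hB0
  nlinarith

end Sparsification

/-! ### Null-space criterion for `ℓ₁` recovery -/

/-- Exact recovery of a sparse vector when no nonzero effectively sparse vector is in the kernel. -/
theorem l1Argmin_eq_singleton {m : Type*} {L S : ℕ} {H : Matrix m (Fin L) ℝ} {x : Fin L → ℝ}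
    (hx : IsSparse S x)
    (hH : ∀ h : Fin L → ℝ, h ≠ 0 → l1norm h ^ 2 ≤ 4 * S * ∑ j, h j ^ 2 → H *ᵥ h ≠ 0) :
    l1Argmin H (H *ᵥ x) = {x} := by
  have key : ∀ z, H *ᵥ z = H *ᵥ x → l1norm z ≤ l1norm x → z = x := by
    intro z hz hle
    by_contra hne
    refine hH (z - x) (sub_ne_zero.mpr hne) ?_ (by rw [Matrix.mulVec_sub, hz, sub_self])
    set T := Finset.univ.filter fun j => x j ≠ 0 with hT
    have hcard : (T.card : ℝ) ≤ S := by
      have : T.card = {i | x i ≠ 0}.ncard := by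
        rw [← Set.ncard_coe_finset]; simp [hT]
      rw [this]
      exact_mod_cast hx
    -- The error has at least half of its `ℓ₁` mass on the support of `x`; Cauchy–Schwarz there
    -- yields the factor `4S`.
    have h1 : l1norm (z - x) ≤ 2 * ∑ j ∈ T, |(z - x) j| := by
      have : l1norm (z - x) ≤
          l1norm z - l1norm x + 2 * ∑ j, if x j ≠ 0 then |(z - x) j| else 0 := by
        simp only [l1norm, Finset.mul_sum, ← Finset.sum_sub_distrib, ← Finset.sum_add_distrib]
        refine Finset.sum_le_sum fun j _ => ?_
        by_cases hj : x j = 0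
        · simp [hj]
        · have := abs_sub_abs_le_abs_sub (x j) (z j)
          rw [abs_sub_comm] at this
          simp only [ne_eq, hj, not_false_eq_true, if_true, Pi.sub_apply]
          linarith
      rw [Finset.sum_filter]
      linarith
    have h2 : (∑ j ∈ T, |(z - x) j|) ^ 2 ≤ S * ∑ j, (z - x) j ^ 2 := by
      refine sq_sum_le_card_mul_sum_sq.trans ?_
      simp only [sq_abs]
      exact mul_le_mul hcard (Finset.sum_le_univ_sum_of_nonneg fun j => sq_nonneg _)
        (Finset.sum_nonneg fun j _ => sq_nonneg _) (Nat.cast_nonneg S)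
    have h3 : 0 ≤ l1norm (z - x) := Finset.sum_nonneg fun j _ => abs_nonneg _
    nlinarith
  ext z
  simp only [l1Argmin, Set.mem_ofPred_eq, Set.mem_singleton_iff]
  constructor
  · rintro ⟨hz, hmin⟩
    exact key z hz (hmin x rfl)
  · rintro rfl
    refine ⟨rfl, fun w hw => ?_⟩
    by_contra! hlt
    rw [key w hw hlt.le] at hlt
    exact lt_irrefl _ hlt

/-! ### The masked matrix and its bad sign patterns -/

/-- The columns of `G` as vectors of the Euclidean space. -/
def euclCol {N L : ℕ} (G : Matrix (Fin N) (Fin L) ℝ) (j : Fin L) : EuclideanSpace ℝ (Fin N) :=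
  WithLp.toLp 2 (G *ᵥ Pi.single j 1)

theorem norm_euclCol {N L : ℕ} (G : Matrix (Fin N) (Fin L) ℝ) (j : Fin L) :
    ‖euclCol G j‖ = colNorm G j := rfl

/-- The linear map `x ↦ H x` into the Euclidean space. -/
def euclMap {N L K : ℕ} (G : Matrix (Fin N) (Fin L) ℝ) (φ : Fin K → Fin L → ℝ) :
    (Fin L → ℝ) →ₗ[ℝ] EuclideanSpace ℝ (Fin K × Fin N) :=
  (WithLp.linearEquiv 2 ℝ (Fin K × Fin N → ℝ)).symm.toLinearMap ∘ₗ (measMatrix G φ).mulVecLin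

theorem norm_sq_euclMap {N L K : ℕ} (G : Matrix (Fin N) (Fin L) ℝ) (φ : Fin K → Fin L → ℝ)
    (x : Fin L → ℝ) :
    ‖euclMap G φ x‖ ^ 2 = ∑ k, ‖∑ j, φ k j • (x j • euclCol G j)‖ ^ 2 := by
  simp only [EuclideanSpace.norm_sq_eq, Fintype.sum_prod_type, Real.norm_eq_abs, sq_abs]
  refine Finset.sum_congr rfl fun k _ => Finset.sum_congr rfl fun n _ => ?_
  congr 1
  change ∑ j, (G * Matrix.diagonal (φ k)) n j * x j = _
  simp only [Matrix.mul_diagonal, WithLp.ofLp_sum, WithLp.ofLp_smul, Finset.sum_apply,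
    Pi.smul_apply, smul_eq_mul, euclCol, Matrix.mulVec_single_one, Matrix.col_apply]
  exact Finset.sum_congr rfl fun j _ => by ring

theorem norm_sq_euclMap_single {N L K : ℕ} (G : Matrix (Fin N) (Fin L) ℝ)
    (ε : Fin K → Fin L → Bool) (j : Fin L) :
    ‖euclMap G (fun k l => boolSign (ε k l)) (Pi.single j 1)‖ ^ 2 = K * colNorm G j ^ 2 := by
  rw [norm_sq_euclMap]
  have : ∀ k, ‖∑ i, boolSign (ε k i) • ((Pi.single j (1 : ℝ) : Fin L → ℝ) i • euclCol G i)‖ ^ 2 =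
      colNorm G j ^ 2 := by
    intro k
    rw [Finset.sum_eq_single j (by simp +contextual) (by simp), Pi.single_eq_same, one_smul,
      norm_smul, mul_pow, Real.norm_eq_abs, sq_abs, boolSign_sq, one_mul, norm_euclCol]
  simp [this]

theorem colNorm_le_thetaMax {N L : ℕ} (G : Matrix (Fin N) (Fin L) ℝ) (j : Fin L) :
    colNorm G j ≤ thetaMax G :=
  le_ciSup (Set.finite_range _).bddAbove j

theorem thetaMin_le_colNorm {N L : ℕ} (G : Matrix (Fin N) (Fin L) ℝ) (j : Fin L) :
    thetaMin G ≤ colNorm G j :=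
  ciInf_le (Set.finite_range _).bddBelow j

/-- The sign patterns for which the measurements of some signed sum of `m` coordinate vectors have
less than half their mean energy. -/
noncomputable def badSigns {N L : ℕ} (G : Matrix (Fin N) (Fin L) ℝ) (K m : ℕ) :
    Finset (Fin K → Fin L → Bool) := by
  classical
  exact Finset.univ.biUnion fun f : Fin m → Fin L × Bool =>
    Finset.univ.filter fun ε : Fin K → Fin L → Bool =>
      ∑ k, ‖∑ j, boolSign (ε k j) • (signedSum f j • euclCol G j)‖ ^ 2 <
        K / 2 * ∑ j, ‖signedSum f j • euclCol G j‖ ^ 2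

theorem card_badSigns_le {N L : ℕ} (G : Matrix (Fin N) (Fin L) ℝ) (K m : ℕ) :
    ((badSigns G K m).card : ℝ) ≤ (2 * L) ^ m * (2 ^ (K * L) * Real.exp (-(K / 24))) := by
  classical
  have h1 : ((badSigns G K m).card : ℝ) ≤ ∑ f : Fin m → Fin L × Bool,
      ((Finset.univ.filter fun ε : Fin K → Fin L → Bool =>
        ∑ k, ‖∑ j, boolSign (ε k j) • (signedSum f j • euclCol G j)‖ ^ 2 <
          K / 2 * ∑ j, ‖signedSum f j • euclCol G j‖ ^ 2).card : ℝ) := by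
    unfold badSigns
    exact_mod_cast Finset.card_biUnion_le
  refine h1.trans ((Finset.sum_le_sum fun f _ => card_signs_lower_tail_le K _).trans ?_)
  simp [mul_comm]

/-- A single column has energy independent of its signs. This case is needed because `log L = 0` at
`L = 1`, so the hypothesis on `K` then gives nothing. -/
theorem badSigns_one {N : ℕ} (G : Matrix (Fin N) (Fin 1) ℝ) (K m : ℕ) :
    badSigns G K m = ∅ := by
  classical
  unfold badSigns
  simp only [Finset.eq_empty_iff_forall_notMem, Finset.mem_biUnion, Finset.mem_univ, true_and,
    Finset.mem_filter, not_exists, Finset.univ_unique, Finset.sum_singleton, not_lt]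
  intro ε f
  simp only [norm_smul _ (signedSum f _ • euclCol G _), mul_pow, Real.norm_eq_abs, sq_abs,
    boolSign_sq, one_mul, Finset.sum_const, Finset.card_univ, Fintype.card_fin, nsmul_eq_mul]
  refine mul_le_mul_of_nonneg_right ?_ (sq_nonneg _)
  linarith [Nat.cast_nonneg (α := ℝ) K]

theorem l1Argmin_eq_singleton_of_notMem_badSigns {N L K S : ℕ} {G : Matrix (Fin N) (Fin L) ℝ}
    (hG : 0 < thetaMin G) (hμ : muRatio G ≤ 2) (hK : 0 < K) {x : Fin L → ℝ} (hx : IsSparse S x)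
    {ε : Fin K → Fin L → Bool} (hε : ε ∉ badSigns G K (81 * S)) :
    l1Argmin (measMatrix G fun k l => boolSign (ε k l))
      ((measMatrix G fun k l => boolSign (ε k l)) *ᵥ x) = {x} := by
  classical
  refine l1Argmin_eq_singleton hx fun h hne hcone hker => ?_
  have hK' : (0 : ℝ) < K := by exact_mod_cast hK
  have hmax : thetaMax G ^ 2 ≤ 2 * thetaMin G ^ 2 := by
    rwa [muRatio, div_le_iff₀ (by positivity)] at hμ
  -- The bound `μ ≤ 2` enters through `B`, which is exactly `4 * a`.
  refine map_ne_zero_of_le_signedSum (S := S) (euclMap G fun k l => boolSign (ε k l))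
    (a := K / 2 * thetaMin G ^ 2) (B := 2 * K * thetaMin G ^ 2) (by positivity) (by positivity)
    (by linarith) (fun j => ?_) (fun f => ?_) hne hcone ?_
  · rw [norm_sq_euclMap_single]
    have h1 : colNorm G j ^ 2 ≤ thetaMax G ^ 2 :=
      pow_le_pow_left₀ (norm_nonneg _) (colNorm_le_thetaMax G j) 2
    nlinarith
  · unfold badSigns at hε
    simp only [Finset.mem_biUnion, Finset.mem_univ, true_and, Finset.mem_filter, not_exists,
      not_lt] at hε
    rw [norm_sq_euclMap]
    refine le_trans ?_ (hε f)
    rw [mul_assoc]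
    refine mul_le_mul_of_nonneg_left ?_ (by positivity)
    rw [Finset.mul_sum]
    refine Finset.sum_le_sum fun j _ => ?_
    rw [norm_smul, mul_pow, Real.norm_eq_abs, sq_abs, norm_euclCol, mul_comm]
    exact mul_le_mul_of_nonneg_left (pow_le_pow_left₀ hG.le (thetaMin_le_colNorm G j) 2)
      (sq_nonneg _)
  · simp [euclMap, hker]

/-! ### From counting sign patterns to probabilities -/

section Masks

variable {Ω : Type*} [MeasurableSpace Ω] {P : Measure Ω} {K L : ℕ} {φ : Fin K → Fin L → Ω → ℝ}

theorem IsRademacherMasks.measureReal_pattern (h : IsRademacherMasks P φ)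
    (ε : Fin K → Fin L → Bool) :
    P.real {ω | ∀ k l, φ k l ω = boolSign (ε k l)} = (2 ^ (K * L))⁻¹ := by
  have h1 := h.indep.measure_inter_preimage_eq_mul Finset.univ
    (sets := fun p => {boolSign (ε p.1 p.2)}) fun p _ => measurableSet_singleton _
  have h2 : ∀ p : Fin K × Fin L, P (φ p.1 p.2 ⁻¹' {boolSign (ε p.1 p.2)}) = 1 / 2 := by
    intro p
    change P {ω | φ p.1 p.2 ω = boolSign (ε p.1 p.2)} = 1 / 2
    cases ε p.1 p.2
    · exact h.prob_neg_one p.1 p.2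
    · exact h.prob_one p.1 p.2
  have h3 : {ω | ∀ k l, φ k l ω = boolSign (ε k l)} =
      ⋂ p ∈ (Finset.univ : Finset (Fin K × Fin L)), φ p.1 p.2 ⁻¹' {boolSign (ε p.1 p.2)} := by
    ext ω
    simp
  rw [h3, Measure.real, h1, Finset.prod_congr rfl fun p _ => h2 p]
  simp

theorem IsRademacherMasks.ae_exists_pattern [IsProbabilityMeasure P] (h : IsRademacherMasks P φ) :
    ∀ᵐ ω ∂P, ∃ ε : Fin K → Fin L → Bool, ∀ k l, φ k l ω = boolSign (ε k l) := by
  have h1 : ∀ k l, ∀ᵐ ω ∂P, φ k l ω = 1 ∨ φ k l ω = -1 := by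
    intro k l
    have hm : ∀ c : ℝ, MeasurableSet {ω | φ k l ω = c} := fun c =>
      h.measurable k l (measurableSet_singleton c)
    have hd : Disjoint {ω | φ k l ω = 1} {ω | φ k l ω = -1} := by
      rw [Set.disjoint_left]
      intro ω h1 h2
      simp only [Set.mem_ofPred_eq] at h1 h2
      norm_num [h1] at h2
    have hu : P ({ω | φ k l ω = 1} ∪ {ω | φ k l ω = -1}) = 1 := by
      rw [measure_union hd (hm _), h.prob_one, h.prob_neg_one, ENNReal.add_halves]
    exact (mem_ae_iff_prob_eq_one ((hm _).union (hm _))).mpr hu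
  have h2 : ∀ᵐ ω ∂P, ∀ k l, φ k l ω = 1 ∨ φ k l ω = -1 :=
    ae_all_iff.mpr fun k => ae_all_iff.mpr fun l => h1 k l
  filter_upwards [h2] with ω hω
  have h3 : ∀ k l, ∃ b, φ k l ω = boolSign b := fun k l =>
    (hω k l).elim (fun e => ⟨true, by simpa [boolSign] using e⟩)
      fun e => ⟨false, by simpa [boolSign] using e⟩
  choose ε hε using h3
  exact ⟨ε, hε⟩

/-- A lower bound for the probability of an event that contains every pattern outside `bad`. -/
theorem IsRademacherMasks.one_sub_le_measureReal [IsProbabilityMeasure P]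
    (h : IsRademacherMasks P φ) (bad : Finset (Fin K → Fin L → Bool)) {T : Set Ω}
    (hT : ∀ ε ∉ bad, ∀ ω, (∀ k l, φ k l ω = boolSign (ε k l)) → ω ∈ T) :
    1 - bad.card * (2 ^ (K * L))⁻¹ ≤ P.real T := by
  set D := ⋃ ε ∈ bad, {ω | ∀ k l, φ k l ω = boolSign (ε k l)} with hD
  -- Only subadditivity is used, so `T` need not be measurable.
  have h1 : P.real (T ∪ D) = 1 := by
    have : (T ∪ D : Set Ω) =ᵐ[P] Set.univ := by
      rw [Filter.eventuallyEq_univ]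
      filter_upwards [h.ae_exists_pattern] with ω ⟨ε, hε⟩
      by_cases hb : ε ∈ bad
      · exact Or.inr (Set.mem_biUnion hb hε)
      · exact Or.inl (hT ε hb ω hε)
    rw [measureReal_congr this, probReal_univ]
  have h2 : P.real D ≤ bad.card * (2 ^ (K * L))⁻¹ := by
    refine (measureReal_biUnion_finset_le _ _).trans (le_of_eq ?_)
    simp [h.measureReal_pattern]
  linarith [measureReal_union_le (μ := P) T D]

end Masks

/-! ### Choice of constants -/

theorem one_le_muRatio {N L : ℕ} {G : Matrix (Fin N) (Fin L) ℝ} (hL : 1 ≤ L)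
    (hG : 0 < thetaMin G) : 1 ≤ muRatio G := by
  rw [muRatio, one_le_div (by positivity)]
  exact pow_le_pow_left₀ hG.le
    ((thetaMin_le_colNorm G ⟨0, hL⟩).trans (colNorm_le_thetaMax G _)) 2

/-- For `L ≥ 2`, `81 S log (2L) ≤ 162 S log L ≤ K/48`, so the union bound costs at most half of the
exponent `K/24`. -/
theorem card_badSigns_mul_le {N L K S : ℕ} (G : Matrix (Fin N) (Fin L) ℝ) (hL : 1 ≤ L)
    (hK : 8000 * S * Real.log L ≤ K) :
    (badSigns G K (81 * S)).card * ((2 : ℝ) ^ (K * L))⁻¹ ≤ Real.exp (-(K / 48)) := by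
  rcases hL.eq_or_lt with rfl | hL2
  · rw [badSigns_one]
    simp [Real.exp_nonneg]
  have hLr : (2 : ℝ) ≤ L := by exact_mod_cast hL2
  refine (mul_le_mul_of_nonneg_right (card_badSigns_le G K (81 * S)) (by positivity)).trans ?_
  have h1 : ((2 * L : ℝ)) ^ (81 * S) * (2 ^ (K * L) * Real.exp (-(K / 24))) * (2 ^ (K * L))⁻¹ =
      Real.exp ((81 * S : ℕ) * Real.log (2 * L) + -(K / 24)) := by
    rw [Real.exp_add, Real.exp_nat_mul, Real.exp_log (by positivity)]
    field_simp
  rw [h1, Real.exp_le_exp, Real.log_mul (by norm_num) (by positivity)]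
  have h2 : Real.log 2 ≤ Real.log L := Real.log_le_log (by norm_num) hLr
  have h3 : (S : ℝ) * Real.log 2 ≤ S * Real.log L := mul_le_mul_of_nonneg_left h2 (by positivity)
  have h4 : 0 ≤ (S : ℝ) * Real.log L := mul_nonneg (by positivity) (Real.log_nonneg (by linarith))
  push_cast
  nlinarith

end MaskedImaging

theorem mainTheorem3 :
    ∃ μ₀ : ℝ, 1 < μ₀ ∧ ∃ c : ℝ, 0 < c ∧ ∃ C : ℝ, 0 < C ∧ ∃ δ : ℝ, 0 < δ ∧ δ < 1 ∧
      ∀ (N L K S : ℕ) (G : Matrix (Fin N) (Fin L) ℝ) (xstar : Fin L → ℝ),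
        1 ≤ L →
        0 < MaskedImaging.thetaMin G →
        MaskedImaging.IsSparse S xstar →
        MaskedImaging.muRatio G ≤ μ₀ →
        c * MaskedImaging.muRatio G ^ 2 * S * Real.log L ≤ K →
        ∀ (Ω : Type*) [MeasurableSpace Ω] (P : Measure Ω) [IsProbabilityMeasure P]
          (φ : Fin K → Fin L → Ω → ℝ),
          MaskedImaging.IsRademacherMasks P φ →
          1 - 2 * Real.exp (-(C * K * min (δ / (2 * MaskedImaging.muRatio G))
                (δ ^ 2 / (2 * MaskedImaging.muRatio G) ^ 2))) ≤
            P.real {ω |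
              MaskedImaging.l1Argmin
                (MaskedImaging.measMatrix G (fun k l => φ k l ω))
                (MaskedImaging.measMatrix G (fun k l => φ k l ω) *ᵥ xstar) = {xstar}} := by
  -- With `δ = 1/2` and `μ ≥ 1` the minimum is at most `1/16`, so `C = 1/3` matches the exponent
  -- `K/48`.
  refine ⟨2, by norm_num, 8000, by norm_num, 1 / 3, by norm_num, 1 / 2, by norm_num, by norm_num,
    ?_⟩
  intro N L K S G xstar hL hG hx hμ hKS Ω _ P _ φ hφ
  have hμ1 := MaskedImaging.one_le_muRatio hL hG
  -- At `K = 0` the claimed bound is `-1`; the kernel argument needs `K > 0`.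
  rcases Nat.eq_zero_or_pos K with rfl | hK
  · refine le_trans ?_ measureReal_nonneg
    norm_num
  have hlog : 0 ≤ (S : ℝ) * Real.log L :=
    mul_nonneg (Nat.cast_nonneg S) (Real.log_nonneg (by exact_mod_cast hL))
  have hKS' : 8000 * S * Real.log L ≤ K := by
    have : 1 ≤ MaskedImaging.muRatio G ^ 2 := one_le_pow₀ hμ1
    nlinarith
  have hmin : min ((1 / 2 : ℝ) / (2 * MaskedImaging.muRatio G))
      ((1 / 2) ^ 2 / (2 * MaskedImaging.muRatio G) ^ 2) ≤ 1 / 16 := by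
    refine (min_le_right _ _).trans ?_
    rw [div_le_iff₀ (by positivity)]
    nlinarith
  have hexp : Real.exp (-((K : ℝ) / 48)) ≤
      Real.exp (-(1 / 3 * K * min ((1 / 2 : ℝ) / (2 * MaskedImaging.muRatio G))
        ((1 / 2) ^ 2 / (2 * MaskedImaging.muRatio G) ^ 2))) := by
    rw [Real.exp_le_exp]
    have := mul_le_mul_of_nonneg_left hmin (by positivity : 0 ≤ 1 / 3 * (K : ℝ))
    linarith
  have hbad := MaskedImaging.card_badSigns_mul_le G hL hKS'
  refine le_trans ?_ (hφ.one_sub_le_measureReal (MaskedImaging.badSigns G K (81 * S)) ?_)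
  · linarith [Real.exp_pos (-((K : ℝ) / 48))]
  · intro ε hε ω hω
    have : (fun k l => φ k l ω) = fun k l => MaskedImaging.boolSign (ε k l) := by
      funext k l
      exact hω k l
    rw [Set.mem_ofPred_eq, this]
    exact MaskedImaging.l1Argmin_eq_singleton_of_notMem_badSigns hG hμ hK hx hε
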